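/- Let $M\ge 1$ and $n\ge 0$ be integers and let $f(x)=a_0x^n+a_1x^{n-1}+\cdots+a_n$ be a polynomial of degree $n$ with real coefficients and $a_0>0$. Put $a_k=0$ for integers $k<0$ and $k>n$, and let $H_M(f)=(a_{Mj-i})_{i,j=1}^{\infty}$ be the infinite generalized Hurwitz matrix of $f$. If $H_M(f)$ is totally nonnegative, i.e. every minor of $H_M(f)$ of every finite order is nonnegative, then $f$ has no zeros in the open sector $$\left\{z\in\mathbb{C}\setminus\{0\} : |\arg z|<\frac{\pi}{M}\right\},$$ where $\arg z\in(-\pi,\pi]$ is the principal argument. (A zero at the origin is not excluded.) -/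

import Mathlib

/-- A (possibly infinite) real matrix with linearly ordered row and column index sets is
totally nonnegative if all its minors, of every finite order `p`, with rows `r 0 < r 1 < ⋯` and
columns `c 0 < c 1 < ⋯`, are nonnegative. -/
def IsTotallyNonneg {ι κ : Type*} [LinearOrder ι] [LinearOrder κ] (A : Matrix ι κ ℝ) : Prop :=
  ∀ (p : ℕ) (r : Fin p ↪o ι) (c : Fin p ↪o κ), 0 ≤ (A.submatrix r c).det

/-- For `f = a₀ xⁿ + a₁ xⁿ⁻¹ + ⋯ + aₙ` of degree `n`, this is `aₖ`, with the convention
`aₖ = 0` for integers `k < 0` and `k > n`. -/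
noncomputable def descCoeff (f : Polynomial ℝ) (k : ℤ) : ℝ :=
  if 0 ≤ k ∧ k ≤ (f.natDegree : ℤ) then f.coeff (f.natDegree - k.toNat) else 0

/-- The infinite generalized Hurwitz matrix `H_M(f) = (a_{M j - i})`, `i, j = 1, 2, 3, …`.
The Lean indices start at `0`, so the Lean entry `(i, j)` is the entry in row `i + 1` and
column `j + 1`. -/
noncomputable def generalizedHurwitz (M : ℕ) (f : Polynomial ℝ) : Matrix ℕ ℕ ℝ :=
  Matrix.of fun i j => descCoeff f ((M : ℤ) * ((j : ℤ) + 1) - ((i : ℤ) + 1))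

/-!
Suppose `f z = 0` with `z = r * exp (i θ)` and `|θ| < π / M`. For a suitable real-linear functional
`ℓ` on `ℂ` (the imaginary part after a rotation), the numbers `u i = ℓ (z ^ i)` are all nonzero, and
`u 0, …, u (N - 1)` fall into about `N * |θ| / π` blocks of constant sign. On every column that
contains all the coefficients of `f`, the vector `u` annihilates `H_M(f)`. The first `N` rows
contain about `N / M` such columns, and these are linearly independent, since the rows carrying
`a₀` cut a triangular matrix out of them. As `|θ| / π < 1 / M`, for large `N` there are more such
columns than sign blocks. A small perturbation of `u` keeps the blocks but moves `u H_M(f)` from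
zero to a vector of strictly alternating signs on these columns, contradicting the variation
diminishing property of totally nonnegative matrices.
-/

open scoped Matrix

theorem det_of_finCons {R : Type*} [CommRing R] {n : ℕ} (v : Fin (n + 1) → R)
    (B : Matrix (Fin n) (Fin (n + 1)) R) :
    (Matrix.of (Fin.cons v B.row : Fin (n + 1) → Fin (n + 1) → R)).det =
      ∑ j : Fin (n + 1), (-1) ^ (j : ℕ) * v j * (B.submatrix id j.succAbove).det := by
  rw [Matrix.det_succ_row_zero]
  rfl

theorem exists_det_submatrix_succAbove_ne_zero {K : Type*} [Field K] {n : ℕ}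
    {B : Matrix (Fin n) (Fin (n + 1)) K} (hB : LinearIndependent K B.row) :
    ∃ j, (B.submatrix id (Fin.succAbove j)).det ≠ 0 := by
  obtain ⟨v, hv⟩ := exists_linearIndependent_cons_of_lt_finrank hB (by simp)
  have hdet : (Matrix.of (Fin.cons v B.row : Fin (n + 1) → Fin (n + 1) → K)).det ≠ 0 :=
    ((Matrix.isUnit_iff_isUnit_det _).1 (Matrix.linearIndependent_rows_iff_isUnit.1 hv)).ne_zero
  contrapose! hdet
  simp only [det_of_finCons, hdet, mul_zero, Finset.sum_const_zero]

theorem exists_span_range_comp_succAbove_eq {K V : Type*} [DivisionRing K] [AddCommGroup V]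
    [Module K V] {n : ℕ} {v : Fin (n + 1) → V} (hv : ¬ LinearIndependent K v) :
    ∃ t : Fin (n + 1), Submodule.span K (Set.range (v ∘ t.succAbove)) =
      Submodule.span K (Set.range v) := by
  rw [linearIndependent_iff_notMem_span] at hv
  push Not at hv
  obtain ⟨t, ht⟩ := hv
  rw [← Set.compl_eq_univ_sdiff, ← Fin.range_succAbove, ← Set.range_comp] at ht
  refine ⟨t, ?_⟩
  rw [← Submodule.span_insert_eq_span ht, Set.range_comp, ← Set.image_insert_eq,
    Fin.range_succAbove, Set.insert_eq, Set.union_compl_self, Set.image_univ]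

theorem vecMul_surjective_of_linearIndependent_col {K m n : Type*} [Field K] [Fintype m]
    [Finite n] {A : Matrix m n K} (hA : LinearIndependent K A.col) :
    Function.Surjective A.vecMul := by
  cases nonempty_fintype n
  have hrank : Module.finrank K (LinearMap.range A.vecMulLinear) = Module.finrank K (n → K) := by
    rw [range_vecMulLinear, ← Matrix.rank_eq_finrank_span_row, ← Matrix.rank_transpose,
      LinearIndependent.rank_matrix (M := Aᵀ) hA, Module.finrank_fintype_fun_eq_card]
  exact LinearMap.range_eq_top.1 (Submodule.eq_top_of_finrank_eq hrank)

theorem exists_pos_forall_pos_add_mul {ι : Type*} [Finite ι] {a : ι → ℝ} (ha : ∀ i, 0 < a i)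
    (b : ι → ℝ) : ∃ δ > 0, ∀ i, 0 < a i + δ * b i := by
  have hnear : ∀ᶠ δ in nhdsWithin (0 : ℝ) (Set.Ioi 0), ∀ i, 0 < a i + δ * b i := by
    rw [Filter.eventually_all]
    intro i
    have hcont : ContinuousAt (fun δ : ℝ => a i + δ * b i) 0 := by fun_prop
    exact (hcont.eventually_const_lt (by simpa using ha i)).filter_mono nhdsWithin_le_nhds
  obtain ⟨δ, hδ, hpos⟩ := (hnear.and self_mem_nhdsWithin).exists
  exact ⟨δ, hpos, hδ⟩

namespace IsTotallyNonneg

theorem submatrix {ι κ ι' κ' : Type*} [LinearOrder ι] [LinearOrder κ] [LinearOrder ι']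
    [LinearOrder κ'] {A : Matrix ι κ ℝ} (hA : IsTotallyNonneg A) (r : ι' ↪o ι) (c : κ' ↪o κ) :
    IsTotallyNonneg (A.submatrix r c) :=
  fun p r' c' => hA p (r'.trans r) (c'.trans c)

theorem mergeRows {ι κ τ : Type*} [Fintype ι] [LinearOrder ι] [LinearOrder κ] [LinearOrder τ]
    {A : Matrix ι κ ℝ} (hA : IsTotallyNonneg A) {β : ι → τ} (hβ : Monotone β) {w : ι → ℝ}
    (hw : ∀ i, 0 ≤ w i) :
    IsTotallyNonneg (Matrix.of fun t j => ∑ i with β i = t, w i * A i j) := by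
  intro p r c
  have hrows : (Matrix.of fun t j => ∑ i with β i = t, w i * A i j).submatrix r c =
      fun t => ∑ i with β i = r t, w i • fun k => A i (c k) := by
    ext t k
    simp [Finset.sum_apply]
  have hexpand := (Matrix.detRowAlternating (R := ℝ) (n := Fin p)).toMultilinearMap.map_sum_finset
    (fun _ i => w i • fun k => A i (c k)) (fun t => {i | β i = r t})
  rw [hrows]
  refine le_of_le_of_eq (Finset.sum_nonneg fun g hg => ?_) hexpand.symm
  have hg_block : ∀ t, β (g t) = r t := by simpa [Fintype.mem_piFinset] using hg
  have hg_mono : StrictMono g := fun t t' htt' =>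
    hβ.reflect_lt (by simpa only [hg_block] using r.strictMono htt')
  rw [MultilinearMap.map_smul_univ]
  exact smul_nonneg (Finset.prod_nonneg fun t _ => hw (g t))
    (hA p (OrderEmbedding.ofStrictMono g hg_mono) c)

theorem not_linearIndependent_row_of_alternating {p : ℕ} {B : Matrix (Fin p) (Fin (p + 1)) ℝ}
    (hB : IsTotallyNonneg B) {y : Fin (p + 1) → ℝ} (hy : y ∈ Submodule.span ℝ (Set.range B.row))
    (halt : ∀ j : Fin (p + 1), 0 < (-1) ^ (j : ℕ) * y j) : ¬ LinearIndependent ℝ B.row := by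
  intro hli
  have hdet : (Matrix.of (Fin.cons y B.row : Fin (p + 1) → Fin (p + 1) → ℝ)).det = 0 := by
    by_contra hne
    exact (linearIndependent_finCons.1 (Matrix.linearIndependent_rows_of_det_ne_zero hne)).2 hy
  -- In the expansion along the row `y` every term is nonnegative, so every minor vanishes.
  have hminor : ∀ j : Fin (p + 1), 0 ≤ (B.submatrix id j.succAbove).det := fun j =>
    hB p (RelEmbedding.refl _) j.succAboveOrderEmb
  rw [det_of_finCons, Finset.sum_eq_zero_iff_of_nonneg
    fun j _ => mul_nonneg (halt j).le (hminor j)] at hdet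
  obtain ⟨j, hj⟩ := exists_det_submatrix_succAbove_ne_zero hli
  exact mul_ne_zero (halt j).ne' hj (hdet j (Finset.mem_univ j))

theorem not_alternating_of_mem_span_row {p : ℕ} {B : Matrix (Fin p) (Fin (p + 1)) ℝ}
    (hB : IsTotallyNonneg B) {y : Fin (p + 1) → ℝ}
    (hy : y ∈ Submodule.span ℝ (Set.range B.row)) :
    ¬ ∀ j : Fin (p + 1), 0 < (-1) ^ (j : ℕ) * y j := by
  intro halt
  have hdep := hB.not_linearIndependent_row_of_alternating hy halt
  induction p with
  | zero => exact hdep linearIndependent_empty_type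
  | succ p ih =>
    -- A redundant row and the last column can be deleted.
    obtain ⟨t, ht⟩ := exists_span_range_comp_succAbove_eq hdep
    have hB' := hB.submatrix t.succAboveOrderEmb Fin.castSuccOrderEmb
    have hy' : LinearMap.funLeft ℝ ℝ Fin.castSucc y ∈
        Submodule.span ℝ (Set.range (B.submatrix t.succAbove Fin.castSucc).row) := by
      rw [← ht] at hy
      have hmap := Submodule.mem_map_of_mem (f := LinearMap.funLeft ℝ ℝ Fin.castSucc) hy
      rwa [Submodule.map_span, ← Set.range_comp] at hmap
    have halt' : ∀ j : Fin (p + 1), 0 < (-1) ^ (j : ℕ) * y j.castSucc := fun j => halt j.castSucc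
    exact ih hB' hy' halt' (hB'.not_linearIndependent_row_of_alternating hy' halt')

theorem not_alternating_vecMul {ι : Type*} [Fintype ι] [LinearOrder ι] {p : ℕ}
    {A : Matrix ι (Fin (p + 1)) ℝ} (hA : IsTotallyNonneg A) {β : ι → Fin p} (hβ : Monotone β)
    {x : ι → ℝ} (hx : ∀ i, 0 ≤ (-1) ^ (β i : ℕ) * x i) :
    ¬ ∀ j : Fin (p + 1), 0 < (-1) ^ (j : ℕ) * (x ᵥ* A) j := by
  refine (hA.mergeRows hβ hx).not_alternating_of_mem_span_row ?_
  refine (Submodule.mem_span_range_iff_exists_fun ℝ).2 ⟨fun t => (-1) ^ (t : ℕ), ?_⟩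
  ext j
  have hblock : ∀ t : Fin p, (-1 : ℝ) ^ (t : ℕ) * ∑ i with β i = t, (-1) ^ (β i : ℕ) * x i * A i j =
      ∑ i with β i = t, x i * A i j := by
    intro t
    rw [Finset.mul_sum]
    refine Finset.sum_congr rfl fun i hi => ?_
    rw [(Finset.mem_filter.1 hi).2, ← mul_assoc, ← mul_assoc, ← mul_pow]
    simp
  simp only [Finset.sum_apply, Pi.smul_apply, Matrix.row_apply, Matrix.of_apply, smul_eq_mul,
    hblock, Finset.sum_fiberwise]
  rfl

theorem not_linearIndependent_col_of_vecMul_eq_zero {ι : Type*} [Fintype ι] [LinearOrder ι]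
    {p : ℕ} {A : Matrix ι (Fin (p + 1)) ℝ} (hA : IsTotallyNonneg A) {β : ι → Fin p}
    (hβ : Monotone β) {u : ι → ℝ} (hu : ∀ i, 0 < (-1) ^ (β i : ℕ) * u i) (huA : u ᵥ* A = 0) :
    ¬ LinearIndependent ℝ A.col := by
  intro hli
  obtain ⟨w, hw⟩ : ∃ w, w ᵥ* A = fun j : Fin (p + 1) => (-1) ^ (j : ℕ) :=
    vecMul_surjective_of_linearIndependent_col hli fun j => (-1) ^ (j : ℕ)
  obtain ⟨δ, hδ, hpos⟩ := exists_pos_forall_pos_add_mul hu fun i => (-1) ^ (β i : ℕ) * w i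
  have hx : ∀ i, 0 ≤ (-1) ^ (β i : ℕ) * (u + δ • w) i := by
    intro i
    calc 0 ≤ (-1) ^ (β i : ℕ) * u i + δ * ((-1) ^ (β i : ℕ) * w i) := (hpos i).le
      _ = (-1) ^ (β i : ℕ) * (u + δ • w) i := by
        rw [Pi.add_apply, Pi.smul_apply, smul_eq_mul]
        ring
  refine hA.not_alternating_vecMul hβ hx fun j => ?_
  rw [Matrix.add_vecMul, Matrix.smul_vecMul, huA, hw, zero_add, Pi.smul_apply, smul_eq_mul,
    mul_left_comm, ← mul_pow]
  simpa using hδ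

end IsTotallyNonneg

section Hurwitz

variable (f : Polynomial ℝ)

theorem descCoeff_zero : descCoeff f 0 = f.leadingCoeff := by
  simp [descCoeff]

theorem descCoeff_of_neg {k : ℤ} (hk : k < 0) : descCoeff f k = 0 :=
  if_neg (by omega)

theorem descCoeff_of_natDegree_lt {k : ℤ} (hk : f.natDegree < k) : descCoeff f k = 0 :=
  if_neg (by omega)

theorem descCoeff_natDegree_sub (i : ℕ) : descCoeff f (f.natDegree - i) = f.coeff i := by
  rcases le_or_gt i f.natDegree with hi | hi
  · rw [descCoeff, if_pos (by omega)]
    congr 1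
    omega
  · rw [descCoeff_of_neg f (by omega), Polynomial.coeff_eq_zero_of_natDegree_lt hi]

theorem sum_generalizedHurwitz_smul_pow {A : Type*} [Semiring A] [Algebra ℝ A] {M N j m : ℕ}
    (hm : M * (j + 1) = m + (f.natDegree + 1)) (hN : M * (j + 1) ≤ N) (z : A) :
    ∑ i ∈ Finset.range N, generalizedHurwitz M f i j • z ^ i = z ^ m * Polynomial.aeval z f := by
  have hentry : ∀ i : ℕ, generalizedHurwitz M f i j = descCoeff f (m + f.natDegree - i) := by
    intro i
    have hm' : (M : ℤ) * (j + 1) = m + (f.natDegree + 1) := mod_cast hm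
    rw [generalizedHurwitz, Matrix.of_apply, hm']
    congr 1
    ring
  obtain ⟨l, rfl⟩ : ∃ l, N = m + l := ⟨N - m, by omega⟩
  rw [Polynomial.aeval_eq_sum_range' (show f.natDegree < l by omega), Finset.sum_range_add,
    Finset.mul_sum, Finset.sum_eq_zero, zero_add]
  · refine Finset.sum_congr rfl fun i _ => ?_
    rw [hentry, pow_add, mul_smul_comm, ← descCoeff_natDegree_sub]
    congr 2
    push_cast
    ring
  · intro i hi
    have hi' : i < m := Finset.mem_range.1 hi
    rw [hentry, descCoeff_of_natDegree_lt f (by omega), zero_smul]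

theorem vecMul_generalizedHurwitz_eq_zero {A : Type*} [Semiring A] [Algebra ℝ A] {z : A}
    (hz : Polynomial.aeval z f = 0) (ℓ : A →ₗ[ℝ] ℝ) {κ : Type*} {M N : ℕ} {c : κ → ℕ}
    (hdeg : ∀ j, f.natDegree < M * (c j + 1)) (hN : ∀ j, M * (c j + 1) ≤ N) :
    (fun i : Fin N => ℓ (z ^ (i : ℕ))) ᵥ* (generalizedHurwitz M f).submatrix Fin.val c = 0 := by
  ext j
  obtain ⟨m, hm⟩ := Nat.exists_eq_add_of_le' (Nat.succ_le_of_lt (hdeg j))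
  have hsum := congrArg ℓ (sum_generalizedHurwitz_smul_pow f hm (hN j) z)
  rw [hz, mul_zero, map_zero, map_sum, Finset.sum_range] at hsum
  simpa [Matrix.vecMul, dotProduct, mul_comm] using hsum

variable {f}

theorem linearIndependent_col_generalizedHurwitz (hf : f ≠ 0) {κ : Type*}
    [Finite κ] [LinearOrder κ] {M N : ℕ} (hM : 1 ≤ M) {c : κ → ℕ} (hc : StrictMono c)
    (hN : ∀ j, M * (c j + 1) ≤ N) :
    LinearIndependent ℝ ((generalizedHurwitz M f).submatrix (Fin.val : Fin N → ℕ) c).col := by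
  cases nonempty_fintype κ
  have hpos : ∀ t, 1 ≤ M * (c t + 1) := fun t => Nat.mul_pos hM (Nat.succ_pos _)
  let r : κ → Fin N := fun t => ⟨M * (c t + 1) - 1, by have := hpos t; have := hN t; omega⟩
  let T : Matrix κ κ ℝ := (generalizedHurwitz M f).submatrix (Fin.val ∘ r) c
  have hT : ∀ t j, T t j = descCoeff f (M * ((c j : ℤ) - c t)) := by
    intro t j
    simp only [T, r, generalizedHurwitz, Matrix.submatrix_apply, Matrix.of_apply,
      Function.comp_apply]
    congr 1
    push_cast [Nat.cast_sub (hpos t)]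
    ring
  have hupper : T.IsUpperTriangular := by
    intro t j htj
    have hlt : (c j : ℤ) - c t < 0 := by
      have hcj : c j < c t := hc htj
      omega
    rw [hT]
    exact descCoeff_of_neg f (mul_neg_of_pos_of_neg (by omega) hlt)
  have hdet : T.det ≠ 0 := by
    rw [Matrix.det_of_isUpperTriangular hupper, Finset.prod_ne_zero_iff]
    intro t _
    rw [hT, sub_self, mul_zero, descCoeff_zero]
    exact Polynomial.leadingCoeff_ne_zero.2 hf
  exact LinearIndependent.of_comp (LinearMap.funLeft ℝ ℝ r)
    (Matrix.linearIndependent_cols_of_det_ne_zero hdet)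

end Hurwitz

theorem neg_one_pow_floor_mul_sin_nonneg {x : ℝ} (hx : 0 ≤ x) :
    0 ≤ (-1) ^ ⌊x / Real.pi⌋₊ * Real.sin x := by
  have hle := Nat.floor_le (div_nonneg hx Real.pi_pos.le)
  have hlt := Nat.lt_floor_add_one (x / Real.pi)
  rw [le_div_iff₀ Real.pi_pos] at hle
  rw [div_lt_iff₀ Real.pi_pos] at hlt
  rw [← Real.sin_sub_nat_mul_pi]
  exact Real.sin_nonneg_of_nonneg_of_le_pi (by linarith) (by linarith)

theorem exists_mem_Ioo_forall_sin_add_mul_ne_zero (θ : ℝ) :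
    ∃ φ ∈ Set.Ioo 0 Real.pi, ∀ i : ℕ, Real.sin (φ + i * θ) ≠ 0 := by
  have hcount : (Set.range fun q : ℤ × ℕ => (q.1 : ℝ) * Real.pi - q.2 * θ).Countable :=
    Set.countable_range _
  obtain ⟨φ, hφ, hmem⟩ := (hcount.dense_compl ℝ).exists_mem_open isOpen_Ioo
    (Set.nonempty_Ioo.2 Real.pi_pos)
  refine ⟨φ, hmem, fun i hsin => hφ ?_⟩
  obtain ⟨k, hk⟩ := Real.sin_eq_zero_iff.1 hsin
  exact ⟨(k, i), by simp [hk]⟩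

theorem im_exp_mul_I_mul_pow (φ : ℝ) (z : ℂ) (i : ℕ) :
    (Complex.exp (φ * Complex.I) * z ^ i).im = ‖z‖ ^ i * Real.sin (φ + i * z.arg) := by
  have hpolar : Complex.exp (φ * Complex.I) * z ^ i =
      ((‖z‖ ^ i : ℝ) : ℂ) * Complex.exp (((φ + i * z.arg : ℝ) : ℂ) * Complex.I) := by
    conv_lhs => rw [← Complex.norm_mul_exp_arg_mul_I z]
    rw [mul_pow, ← Complex.exp_nat_mul, mul_left_comm, ← Complex.exp_add]
    push_cast
    congr 2
    ring
  rw [hpolar, Complex.im_ofReal_mul, Complex.exp_ofReal_mul_I_im]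

theorem exists_monotone_sign_pow_of_arg_nonneg {z : ℂ} (hz : z ≠ 0) (harg : 0 ≤ z.arg) :
    ∃ (ℓ : ℂ →ₗ[ℝ] ℝ) (β : ℕ → ℕ), Monotone β ∧ (∀ i, 0 < (-1) ^ β i * ℓ (z ^ i)) ∧
      ∀ i, (β i : ℝ) ≤ 1 + i * (z.arg / Real.pi) := by
  have hπ := Real.pi_pos
  obtain ⟨φ, ⟨hφ0, hφπ⟩, hφ⟩ := exists_mem_Ioo_forall_sin_add_mul_ne_zero z.arg
  refine ⟨Complex.imLm ∘ₗ LinearMap.mulLeft ℝ (Complex.exp (φ * Complex.I)),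
    fun i => ⌊(φ + i * z.arg) / Real.pi⌋₊, fun i i' hii' => ?_, fun i => ?_, fun i => ?_⟩
  · dsimp only
    gcongr
  · have hsin := neg_one_pow_floor_mul_sin_nonneg (x := φ + i * z.arg) (by positivity)
    have hpos := hsin.lt_of_ne' (mul_ne_zero (pow_ne_zero _ (by norm_num)) (hφ i))
    simp only [LinearMap.comp_apply, LinearMap.mulLeft_apply, Complex.imLm_coe,
      im_exp_mul_I_mul_pow]
    rw [mul_left_comm]
    exact mul_pos (pow_pos (norm_pos_iff.2 hz) i) hpos
  · calc (⌊(φ + i * z.arg) / Real.pi⌋₊ : ℝ)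
        ≤ (φ + i * z.arg) / Real.pi := Nat.floor_le (by positivity)
      _ = φ / Real.pi + i * (z.arg / Real.pi) := by ring
      _ ≤ 1 + i * (z.arg / Real.pi) := by
        gcongr
        exact (div_le_one hπ).2 hφπ.le

theorem exists_monotone_sign_pow {z : ℂ} (hz : z ≠ 0) :
    ∃ (ℓ : ℂ →ₗ[ℝ] ℝ) (β : ℕ → ℕ), Monotone β ∧ (∀ i, 0 < (-1) ^ β i * ℓ (z ^ i)) ∧
      ∀ i, (β i : ℝ) ≤ 1 + i * (|z.arg| / Real.pi) := by
  rcases le_or_gt 0 z.arg with harg | harg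
  · rw [abs_of_nonneg harg]
    exact exists_monotone_sign_pow_of_arg_nonneg hz harg
  · have hconj : (starRingEnd ℂ z).arg = |z.arg| := by
      rw [Complex.arg_conj, if_neg (by linarith [Real.pi_pos]), abs_of_neg harg]
    obtain ⟨ℓ, β, hβ, hsign, hle⟩ := exists_monotone_sign_pow_of_arg_nonneg
      (z := starRingEnd ℂ z) (by simpa using hz) (hconj ▸ abs_nonneg _)
    refine ⟨ℓ ∘ₗ Complex.conjAe.toLinearMap, β, hβ, fun i => ?_, fun i => hconj ▸ hle i⟩
    simpa using hsign i

theorem exists_apply_mul_add_lt {β : ℕ → ℕ} {a q : ℝ} (hβ : ∀ i, (β i : ℝ) ≤ a + i * q) {M : ℕ}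
    (hMq : M * q < 1) (b : ℕ) : ∃ p, β (M * (b + p)) < p := by
  obtain ⟨p, hp⟩ := exists_nat_gt ((a + M * b * q) / (1 - M * q))
  rw [div_lt_iff₀ (sub_pos.2 hMq)] at hp
  refine ⟨p, Nat.cast_lt.1 ((hβ _).trans_lt ?_)⟩
  push_cast
  linarith

theorem mainTheorem1 (M : ℕ) (hM : 1 ≤ M) (f : Polynomial ℝ) (ha₀ : 0 < f.leadingCoeff)
    (hTN : IsTotallyNonneg (generalizedHurwitz M f)) :
    ∀ z : ℂ, z ≠ 0 → |z.arg| < Real.pi / (M : ℝ) → Polynomial.aeval z f ≠ 0 := by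
  intro z hz harg hroot
  have hf : f ≠ 0 := Polynomial.leadingCoeff_ne_zero.1 ha₀.ne'
  obtain ⟨ℓ, β, hβ, hsign, hle⟩ := exists_monotone_sign_pow hz
  have hslope : M * (|z.arg| / Real.pi) < 1 := by
    rwa [← mul_div_assoc, div_lt_one Real.pi_pos, ← lt_div_iff₀' (by exact_mod_cast hM)]
  obtain ⟨p, hp⟩ := exists_apply_mul_add_lt hle hslope (f.natDegree + 1)
  let N := M * (f.natDegree + 1 + p)
  let c : Fin (p + 1) ↪o ℕ := OrderEmbedding.ofStrictMono (fun j => f.natDegree + j)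
    fun j j' hjj' => by simpa using hjj'
  have hdeg : ∀ j, f.natDegree < M * (c j + 1) := fun j =>
    (Nat.lt_succ_of_le (Nat.le_add_right _ _)).trans_le (Nat.le_mul_of_pos_left _ hM)
  have hN : ∀ j, M * (c j + 1) ≤ N := fun j =>
    Nat.mul_le_mul_left M (show f.natDegree + (j : ℕ) + 1 ≤ _ by omega)
  exact (hTN.submatrix (Fin.valOrderEmb N) c).not_linearIndependent_col_of_vecMul_eq_zero
    (β := fun i => ⟨β i, (hβ i.2.le).trans_lt hp⟩) (fun _ _ h => hβ h) (fun i => hsign i)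
    (vecMul_generalizedHurwitz_eq_zero f hroot ℓ hdeg hN)
    (linearIndependent_col_generalizedHurwitz hf hM c.strictMono hN)
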